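/- **Setup.** For each sample size $n$ let $Z_i=(X_i,Y_i)\in\mathcal X\times\mathcal Y$, $\mathcal Y\subseteq\mathbb R$, $i=1,\dots,n$, be independent observations, $\mathbf F$ a real vector space of functions $\mathcal X\to\mathbb R$ with a (semi)norm $\|\cdot\|$, and $\rho_f:\mathcal X\times\mathcal Y\to\mathbb R$, $f\in\mathbf F$, a loss with $\rho_f(Z_i)$ integrable and $f\mapsto\rho_f(z)$ convex for every $z$. Let $\psi_1,\dots,\psi_p\in\mathbf F$ be measurable, $f_\beta=\sum_{j}\beta_j\psi_j$ for $\beta\in\mathbb R^p$, and $\Phi\subseteq\mathbb R^p$ convex. All these objects may depend on $n$. Write $P_n\rho_f=\frac1n\sum_i\rho_f(Z_i)$, $P\rho_f=\frac1n\sum_iE\rho_f(Z_i)$; the target $f^0$ is the minimizer of $P\rho_f$ over $\mathbf F$ (unique up to $\|\cdot\|$), and $\Xi(f)=P\rho_f-P\rho_{f^0}$. The target is linear: $f^0=f_{\beta^0}$ with $0\neq\beta^0\in\Phi$; $S^0=\{j:\beta^0_j\ne0\}$. The elastic net $\hat\beta$ minimizes $P_n\rho_{f_\beta}+\lambda_1\|\beta\|_1+\lambda_2\|\beta\|_2^2$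 over $\beta\in\Phi$. For $S\subseteq\{1,\dots,p\}$ let $\beta_S$ be $\beta$ with the coordinates outside $S$ set to $0$, let $\beta^*$ be the oracle defined below, and $$\phi^2(S)=\inf\Big\{\frac{\|f_\beta\|^2}{\|\beta_S\|_2^2}:\ \beta\ne0,\ \|\beta_{S^c}\|_1\le L_n\|\beta_S\|_2\Big\},\qquad L_n=3\Big(\sqrt{|S|}+\frac{2\lambda_2\|\beta^*_S\|_2}{\lambda_1}\Big).$$ **Assumptions.** There are constants $K,D,c>0$ and $L\ge 8$, not depending on $n$, such that for all sufficiently large $n$: 1. (Quadratic margin) for some $\eta=\eta_n>0$ and $\mathbf F_{\rm local}=\{f\in\mathbf F:\sup_{x}|f(x)-f^0(x)|\le\eta\}$, $\Xi(f)\ge c\|f-f^0\|^2$ for all $f\in\mathbf F_{\rm local}$. Let $H(v)=\sup_{u\ge0}\{uv-cu^2\}$. 2. (Oracle and tuning) $\beta^*$ minimizes $3\,\Xi(f_\beta)+2H\big(6\lambda_1\sqrt{|S^0|}/\phi(S^0)\big)$ over the $\beta$ with $\{j:\beta_j\neq0\}=S^0$, with $L_n=6\sqrt{|S^0|}$ in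 $\phi(S^0)$ (this is the oracle objective $3\,\Xi(f_\beta)+2H\big((4\lambda_1\sqrt{|S^0|}+4\lambda_2\|\beta\|_2)/\phi(S^0)\big)$ with $\lambda_2=\lambda_1\sqrt{|S^0|}/(2\|\beta\|_2)$); the tuning parameter is $\lambda_2=\lambda_1\sqrt{|S^0|}/(2\|\beta^*\|_2)$, and $8\lambda_0\le\lambda_1\le L\lambda_0$. 3. With $2\Delta^*=3\,\Xi(f_{\beta^*})+2H\big((4\lambda_1\sqrt{|S^0|}+4\lambda_2\|\beta^*\|_2)/\phi(S^0)\big)$ and $M^*=\Delta^*/\lambda_0$: $f_{\beta^*}\in\mathbf F_{\rm local}$, and $f_\beta\in\mathbf F_{\rm local}$ whenever $\|\beta-\beta^*\|_1\le M^*$. 4. $\phi^2(S^0)$ is bounded away from $0$, uniformly in $n$. 5. $\rho_f(x,y)=\gamma(y,f(x))+c(f)$ with $|\gamma(y,f_\beta(x))-\gamma(y,f_{\tilde\beta}(x))|\le D|f_\beta(x)-f_{\tilde\beta}(x)|$ for all $x,y$ and $\beta,\tilde\beta\in\Phi$; $\frac1n\sum_i\max_jE\psi_j^2(X_i)\le1$;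 $\max_j\sup_x|\psi_j(x)|\le K$; $p\ge2$ and $\log p\le n$. **Claim.** For every $K>0$ there is a constant $d>0$, depending only on $K$, such that with $\lambda_0=dD\sqrt{\log(p)/n}$ the following holds. If $p\to\infty$, $p=O(\exp(n^a))$ and $|S^0|=O(n^b)$ with $a>0$, $b\ge0$, $a+2b<1$, then under the above assumptions $\|\hat\beta-\beta^0\|_1\to0$ in probability as $n\to\infty$. -/

import Mathlib

open MeasureTheory ProbabilityTheory Filter Topology Asymptotics

universe u v

noncomputable section

namespace ElasticNet

/-- The data of the problem at sample size `n`: a sample `(X i, Y i)`, `i < n`, of independent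
observations, a vector space `F` of real functions on the covariate space with a (semi)norm
(for instance the `L²(P)`-seminorm), a loss `ρ f (x, y)` which is convex in `f`, basis functions
`ψ j ∈ F`, `j < p`, and a convex parameter set `Φ`. -/
structure Model {Ω : Type u} [MeasurableSpace Ω] (P : Measure Ω) (n : ℕ) where
  /-- number of basis functions -/
  p : ℕ
  /-- covariate space -/
  XSpace : Type v
  [measX : MeasurableSpace XSpace]
  /-- response space -/
  YSpace : Set ℝ
  X : Fin n → Ω → XSpace
  Y : Fin n → Ω → YSpace
  measurable_X : ∀ i, Measurable (X i)
  measurable_Y : ∀ i, Measurable (Y i)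
  indep : iIndepFun (fun i ω => (X i ω, Y i ω)) P
  F : Submodule ℝ (XSpace → ℝ)
  N : Seminorm ℝ F
  ρ : F → XSpace × YSpace → ℝ
  measurable_ρ : ∀ f, Measurable (ρ f)
  integrable_ρ : ∀ f i, Integrable (fun ω => ρ f (X i ω, Y i ω)) P
  convex_ρ : ∀ z, ConvexOn ℝ Set.univ (fun f => ρ f z)
  ψ : Fin p → F
  measurable_ψ : ∀ j, Measurable (ψ j : XSpace → ℝ)
  Φ : Set (Fin p → ℝ)
  convex_Φ : Convex ℝ Φ

attribute [instance] Model.measX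

/-- The `ℓ₁`-norm. -/
def l1 {p : ℕ} (β : Fin p → ℝ) : ℝ := ∑ j, |β j|

/-- The `ℓ₂`-norm. -/
def l2 {p : ℕ} (β : Fin p → ℝ) : ℝ := √(∑ j, β j ^ 2)

/-- `β_S`: the coordinates outside `S` are set to zero. -/
def restrict {p : ℕ} (S : Finset (Fin p)) (β : Fin p → ℝ) : Fin p → ℝ :=
  fun j => if j ∈ S then β j else 0

/-- `S_β`: the indices of the nonzero coefficients. -/
def supp {p : ℕ} (β : Fin p → ℝ) : Finset (Fin p) := Finset.univ.filter (fun j => β j ≠ 0)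

/-- The convex conjugate `H v = sup {u v - G u : u ≥ 0}` of a function `G` on `[0, ∞)`. -/
def convexConjugate (G : ℝ → ℝ) (v : ℝ) : ℝ := sSup ((fun u => u * v - G u) '' Set.Ici 0)

/-- The tuning rule `λ₂ = λ₁ √s_β / (2 ‖β‖₂)`. -/
def tunedLambda2 {p : ℕ} (lam1 : ℝ) (β : Fin p → ℝ) : ℝ :=
  lam1 * √((supp β).card : ℝ) / (2 * l2 β)

namespace Model

variable {Ω : Type u} [MeasurableSpace Ω] {P : Measure Ω} {n : ℕ} (M : Model.{u, v} P n)

/-- `f_β = ∑ j, β j ψ j`. -/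
def lin (β : Fin M.p → ℝ) : M.F := ∑ j, β j • M.ψ j

/-- The empirical risk `P_n ρ_f`. -/
def empRisk (f : M.F) (ω : Ω) : ℝ := (1 / (n : ℝ)) * ∑ i, M.ρ f (M.X i ω, M.Y i ω)

/-- The population risk `P ρ_f`. -/
def risk (f : M.F) : ℝ := (1 / (n : ℝ)) * ∑ i, ∫ ω, M.ρ f (M.X i ω, M.Y i ω) ∂P

/-- `f₀` is the target: the minimizer of the population risk over `F`, unique with respect to
the (semi)norm of `F`. -/
def IsTarget (f₀ : M.F) : Prop :=
  (∀ f, M.risk f₀ ≤ M.risk f) ∧ ∀ g, (∀ f, M.risk g ≤ M.risk f) → M.N (g - f₀) = 0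

/-- The excess risk `Ξ(f)` over the target `f₀`. -/
def excessRisk (f₀ f : M.F) : ℝ := M.risk f - M.risk f₀

/-- The elastic net criterion. -/
def criterion (lam1 lam2 : ℝ) (ω : Ω) (β : Fin M.p → ℝ) : ℝ :=
  M.empRisk (M.lin β) ω + lam1 * l1 β + lam2 * l2 β ^ 2

/-- `b` is an elastic net estimate at the sample point `ω`. -/
def IsElasticNet (lam1 lam2 : ℝ) (ω : Ω) (b : Fin M.p → ℝ) : Prop :=
  b ∈ M.Φ ∧ ∀ β ∈ M.Φ, M.criterion lam1 lam2 ω b ≤ M.criterion lam1 lam2 ω β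

/-- `F_local`: the functions of `F` within sup-distance `η` of the target. -/
def localSet (f₀ : M.F) (η : ℝ) : Set M.F :=
  {f | ∀ x, |(f : M.XSpace → ℝ) x - (f₀ : M.XSpace → ℝ) x| ≤ η}

/-- The margin condition with margin function `G`. -/
def MarginCondition (f₀ : M.F) (η : ℝ) (G : ℝ → ℝ) : Prop :=
  ∀ f ∈ M.localSet f₀ η, G (M.N (f - f₀)) ≤ M.excessRisk f₀ f

/-- The adaptive restricted eigenvalue `φ²(S)`; the restricted set has the constant
`L_n = 3 (√|S| + 2 λ₂ ‖b_S‖₂ / λ₁)`, where `b` is the reference vector. -/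
def phiSq (lam1 lam2 : ℝ) (b : Fin M.p → ℝ) (S : Finset (Fin M.p)) : ℝ :=
  sInf {r : ℝ | ∃ β : Fin M.p → ℝ, β ≠ 0 ∧
    l1 (restrict Sᶜ β) ≤
      3 * (√(S.card : ℝ) + 2 * lam2 * l2 (restrict S b) / lam1) * l2 (restrict S β) ∧
    r = M.N (M.lin β) ^ 2 / l2 (restrict S β) ^ 2}

/-- The function `3 Ξ(f_β) + 2 H((4 λ₁ √s_β + 4 λ₂ ‖β‖₂) / φ(S_β))`, with `H` the convex conjugate
of the margin function `G`. -/
def oracleObjective (f₀ : M.F) (G : ℝ → ℝ) (lam1 lam2 : ℝ) (β : Fin M.p → ℝ) : ℝ :=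
  3 * M.excessRisk f₀ (M.lin β) +
    2 * convexConjugate G
      ((4 * lam1 * √((supp β).card : ℝ) + 4 * lam2 * l2 β) / √(M.phiSq lam1 lam2 β (supp β)))

/-- `b` is an oracle for the collection `Γ` of index sets when `λ₂` is tuned to the candidate,
`λ₂ = λ₁ √s_β / (2 ‖β‖₂)`: it minimizes, over the `β` with `S_β ∈ Γ`, the oracle objective, which
then reads `3 Ξ(f_β) + 2 H(6 λ₁ √s_β / φ(S_β))`, where `φ(S_β)` has `L_n = 6 √s_β`. -/
def IsTunedOracle (f₀ : M.F) (G : ℝ → ℝ) (lam1 : ℝ) (Γ : Set (Finset (Fin M.p)))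
    (b : Fin M.p → ℝ) : Prop :=
  supp b ∈ Γ ∧ ∀ β, supp β ∈ Γ →
    M.oracleObjective f₀ G lam1 (tunedLambda2 lam1 b) b ≤
      M.oracleObjective f₀ G lam1 (tunedLambda2 lam1 β) β

/-- `Δ*`: half the oracle objective at `b = β*`. -/
def Delta (f₀ : M.F) (G : ℝ → ℝ) (lam1 lam2 : ℝ) (b : Fin M.p → ℝ) : ℝ :=
  M.oracleObjective f₀ G lam1 lam2 b / 2

/-- The oracle `f_b` and all `f_β` with `‖β - b‖₁ ≤ M* = Δ* / λ₀` lie in `F_local`. -/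
def LocalCondition (f₀ : M.F) (η : ℝ) (G : ℝ → ℝ) (lam0 lam1 lam2 : ℝ)
    (b : Fin M.p → ℝ) : Prop :=
  M.lin b ∈ M.localSet f₀ η ∧
    ∀ β, l1 (β - b) ≤ M.Delta f₀ G lam1 lam2 b / lam0 → M.lin β ∈ M.localSet f₀ η

/-- The loss is `ρ_f(x, y) = γ(y, f(x)) + c(f)` with `γ(y, ·)` Lipschitz with constant `D` over
`{f_β : β ∈ Φ}`. -/
def LipschitzLoss (D : ℝ) : Prop :=
  ∃ (γ : M.YSpace → ℝ → ℝ) (c : M.F → ℝ),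
    (∀ f x y, M.ρ f (x, y) = γ y ((f : M.XSpace → ℝ) x) + c f) ∧
    ∀ x y, ∀ β ∈ M.Φ, ∀ β' ∈ M.Φ,
      |γ y ((M.lin β : M.XSpace → ℝ) x) - γ y ((M.lin β' : M.XSpace → ℝ) x)| ≤
        D * |(M.lin β : M.XSpace → ℝ) x - (M.lin β' : M.XSpace → ℝ) x|

/-- `(1/n) ∑ i, max_j E ψ_j(X_i)² ≤ 1` and `max_j ‖ψ_j‖_∞ ≤ K`. -/
def BoundedBasis (K : ℝ) : Prop :=
  (1 / (n : ℝ)) * ∑ i, ⨆ j, ∫ ω, (M.ψ j : M.XSpace → ℝ) (M.X i ω) ^ 2 ∂P ≤ 1 ∧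
    ∀ j x, |(M.ψ j : M.XSpace → ℝ) x| ≤ K

end Model

end ElasticNet

end

/-! The plan is to reduce the claim to the oracle inequality `‖β̂ - β⁰‖₁ ≤ M* = Δ*/λ₀` with
probability at least `1 - 2/p`.

On a linear target the oracle is `β⁰` itself (`eq_of_isTunedOracle`): the tuning rule makes the
conjugate term the same for every candidate supported on `S⁰`, so only the excess risk is compared,
and margin and eigenvalue conditions identify the minimizer. Hence `Δ* = H(6 λ₁ √s / φ) = 9 λ₁² s /
(c φ²)`, and `M*` is of order `√(log p / n) s`, which vanishes when `a + 2b < 1` (`tendsto_rate`).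

The deterministic half (`l1_elasticNet_sub_le`) supposes that the centred empirical process
increases by at most `Δ*` from `β⁰` to any point of `Φ` in the `ℓ₁`-ball of radius `M*`. Convexity
allows `β̂` to be pulled towards `β⁰` into this ball. The basic inequality there, with the
restricted eigenvalue and the quadratic margin, puts the pulled point within `M*/2`, which forces
`β̂` into the ball.

The probabilistic half (`measure_exists_lt_risk_sub_empRisk_le`) bounds the process over the ball by
a Chernoff argument. Observations are treated one at a time: each is symmetrized and contracted from
the Lipschitz loss to the linear functions (`lintegral_expMax_le`), after which `ℓ₁`-`ℓ∞` duality
leaves a sum of `p` hyperbolic cosines. With `d = 4K` the resulting bound `4 K D √(log p / n) M*` is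
`λ₀ M* = Δ*`. -/

namespace ElasticNet

/-! ### Symmetrization and contraction for the exponential of a finite maximum. -/

section ExpMax

variable {ι : Type*} [Fintype ι] [Nonempty ι]

/-- The exponential of the largest coordinate. -/
noncomputable def expMax (a : ι → ℝ) : ℝ := Real.exp (Finset.univ.sup' Finset.univ_nonempty a)

lemma exp_le_expMax (a : ι → ℝ) (i : ι) : Real.exp (a i) ≤ expMax a :=
  Real.exp_le_exp.2 (Finset.le_sup' a (Finset.mem_univ i))

lemma exists_expMax_eq (a : ι → ℝ) : ∃ i, expMax a = Real.exp (a i) := by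
  obtain ⟨i, -, hi⟩ := Finset.exists_mem_eq_sup' Finset.univ_nonempty a
  exact ⟨i, by rw [expMax, hi]⟩

lemma expMax_pos (a : ι → ℝ) : 0 < expMax a := Real.exp_pos _

lemma expMax_le_of_forall {a : ι → ℝ} {C : ℝ} (h : ∀ i, Real.exp (a i) ≤ C) : expMax a ≤ C := by
  obtain ⟨i, hi⟩ := exists_expMax_eq a
  exact hi ▸ h i

lemma measurable_expMax {Z : Type*} [MeasurableSpace Z] {f : Z → ι → ℝ}
    (hf : ∀ i, Measurable fun z => f z i) : Measurable fun z => expMax (f z) := by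
  refine Real.measurable_exp.comp ?_
  have : (fun z => Finset.univ.sup' Finset.univ_nonempty (f z)) =
      Finset.univ.sup' Finset.univ_nonempty (fun i z => f z i) := by
    ext z
    rw [Finset.sup'_apply]
  rw [this]
  exact Finset.measurable_sup' _ fun i _ => hf i

/-- The arithmetic-geometric mean inequality splits the exponential of a centred increment `m - g`
into a part with the mean and a part with the observation. Once Jensen turns the mean back into `g`,
both signs of `2 g` appear with weight one half. This gives symmetrization without an independent
copy of the sample. -/
lemma expMax_add_sub_le (a m g : ι → ℝ) :
    expMax (fun i => a i + m i - g i) ≤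
      (expMax (fun i => a i + 2 * m i) + expMax (fun i => a i - 2 * g i)) / 2 := by
  refine expMax_le_of_forall fun i => ?_
  have h1 := exp_le_expMax (fun i => a i + 2 * m i) i
  have h2 := exp_le_expMax (fun i => a i - 2 * g i) i
  have h3 : Real.exp (a i + m i - g i) ≤
      (Real.exp (a i + 2 * m i) + Real.exp (a i - 2 * g i)) / 2 := by
    have e1 : Real.exp (a i + 2 * m i) = Real.exp ((a i + 2 * m i) / 2) ^ 2 := by
      rw [← Real.exp_nat_mul]; congr 1; push_cast; ring
    have e2 : Real.exp (a i - 2 * g i) = Real.exp ((a i - 2 * g i) / 2) ^ 2 := by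
      rw [← Real.exp_nat_mul]; congr 1; push_cast; ring
    have e3 : Real.exp (a i + m i - g i) =
        Real.exp ((a i + 2 * m i) / 2) * Real.exp ((a i - 2 * g i) / 2) := by
      rw [← Real.exp_add]; congr 1; ring
    rw [e1, e2, e3]
    nlinarith [sq_nonneg (Real.exp ((a i + 2 * m i) / 2) - Real.exp ((a i - 2 * g i) / 2))]
  linarith

/-- Increments of `exp` grow with the base point and with the step. Only the larger step has to be
nonnegative. -/
lemma exp_sub_exp_le {u v r s : ℝ} (huv : u ≤ v) (hrs : r ≤ s) (hs : 0 ≤ s) :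
    Real.exp (u + r) - Real.exp u ≤ Real.exp (v + s) - Real.exp v := by
  rw [Real.exp_add, Real.exp_add]
  have h1 : Real.exp u ≤ Real.exp v := Real.exp_le_exp.2 huv
  have h2 : Real.exp r ≤ Real.exp s := Real.exp_le_exp.2 hrs
  have h3 : 1 ≤ Real.exp s := Real.one_le_exp hs
  nlinarith [Real.exp_pos u, Real.exp_pos v, mul_nonneg (sub_nonneg.2 h1) (sub_nonneg.2 h3),
    mul_nonneg (Real.exp_pos u).le (sub_nonneg.2 h2)]

/-- The contraction principle for one Rademacher sign. -/
lemma expMax_contraction (a f t : ι → ℝ) (hft : ∀ i, |f i| ≤ |t i|)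
    (hlip : ∀ i j, |f i - f j| ≤ |t i - t j|) :
    expMax (fun i => a i + f i) + expMax (fun i => a i - f i) ≤
      expMax (fun i => a i + t i) + expMax (fun i => a i - t i) := by
  obtain ⟨i, hi⟩ := exists_expMax_eq (fun i => a i + f i)
  obtain ⟨j, hj⟩ := exists_expMax_eq (fun i => a i - f i)
  have hij : a j + f j ≤ a i + f i :=
    Real.exp_le_exp.1 (hi ▸ exp_le_expMax (fun i => a i + f i) j)
  have hji : a i - f i ≤ a j - f j :=
    Real.exp_le_exp.1 (hj ▸ exp_le_expMax (fun i => a i - f i) i)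
  rw [hi, hj]
  -- Here `i` and `j` maximize the two terms on the left. Among nonnegative `x` and `y`, the larger
  -- decides which signs to give them on the right, and the difference is then an instance of
  -- `exp_sub_exp_le`. If `x` and `y` have opposite signs, the bound holds term by term.
  have key : ∀ x y : ℝ, |f i| ≤ |x| → |f j| ≤ |y| → |f i - f j| ≤ |x - y| → 0 ≤ x →
      Real.exp (a i + f i) + Real.exp (a j - f j) ≤
        max (Real.exp (a i + x) + Real.exp (a j - y))
          (Real.exp (a j + y) + Real.exp (a i - x)) := by
    intro x y hx hy hxy hx0
    rw [abs_of_nonneg hx0] at hx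
    obtain ⟨hx1, hx2⟩ := abs_le.1 hx
    rcases le_total 0 y with hy0 | hy0
    · rw [abs_of_nonneg hy0] at hy
      obtain ⟨hy1, hy2⟩ := abs_le.1 hy
      rcases le_total y x with hyx | hyx
      · rw [abs_of_nonneg (sub_nonneg.2 hyx)] at hxy
        obtain ⟨h1, h2⟩ := abs_le.1 hxy
        refine le_max_of_le_left ?_
        have := exp_sub_exp_le (u := a j - y) (v := a i + f i) (r := y - f j) (s := x - f i)
          (by linarith) (by linarith) (by linarith)
        rw [show a j - y + (y - f j) = a j - f j by ring,
          show a i + f i + (x - f i) = a i + x by ring] at this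
        linarith
      · rw [abs_of_nonpos (sub_nonpos.2 hyx)] at hxy
        obtain ⟨h1, h2⟩ := abs_le.1 hxy
        refine le_max_of_le_right ?_
        have := exp_sub_exp_le (u := a i - x) (v := a j - f j) (r := f i + x) (s := y + f j)
          (by linarith) (by linarith) (by linarith)
        rw [show a i - x + (f i + x) = a i + f i by ring,
          show a j - f j + (y + f j) = a j + y by ring] at this
        linarith
    · rw [abs_of_nonpos hy0] at hy
      obtain ⟨hy1, hy2⟩ := abs_le.1 hy
      exact le_max_of_le_left (add_le_add (Real.exp_le_exp.2 (by linarith))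
        (Real.exp_le_exp.2 (by linarith)))
  have p1 := exp_le_expMax (fun i => a i + t i) i
  have p2 := exp_le_expMax (fun i => a i + t i) j
  have p3 := exp_le_expMax (fun i => a i - t i) i
  have p4 := exp_le_expMax (fun i => a i - t i) j
  -- The right-hand side is unchanged under `t ↦ -t`, so `t i` may be taken nonnegative.
  rcases le_total 0 (t i) with h0 | h0
  · refine (key (t i) (t j) (hft i) (hft j) (hlip i j) h0).trans (max_le ?_ ?_) <;> linarith
  · refine (key (-t i) (-t j) (by simpa using hft i) (by simpa using hft j) ?_
      (by linarith)).trans (max_le ?_ ?_)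
    · rw [show -t i - -t j = -(t i - t j) by ring, abs_neg]
      exact hlip i j
    · rw [← sub_eq_add_neg, sub_neg_eq_add]; linarith
    · rw [← sub_eq_add_neg, sub_neg_eq_add]; linarith

variable {Z : Type*} [MeasurableSpace Z]

lemma integrable_expMax {μ : Measure Z} [IsFiniteMeasure μ] {f : Z → ι → ℝ} {B : ℝ}
    (hf : ∀ i, Measurable fun z => f z i) (hB : ∀ i z, f z i ≤ B) :
    Integrable (fun z => expMax (f z)) μ := by
  refine Integrable.of_bound (measurable_expMax hf).aestronglyMeasurable (Real.exp B)
    (Eventually.of_forall fun z => ?_)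
  rw [Real.norm_of_nonneg (expMax_pos _).le]
  exact expMax_le_of_forall fun i => Real.exp_le_exp.2 (hB i z)

/-- Symmetrization and contraction for one observation. -/
lemma lintegral_expMax_le (μ : Measure Z) [IsProbabilityMeasure μ] (a : ι → ℝ) (g t : ι → Z → ℝ)
    {B : ℝ} (hg : ∀ i, Measurable (g i)) (hB : ∀ i z, |g i z| ≤ B)
    (hgt : ∀ i z, |g i z| ≤ |t i z|) (hlip : ∀ i j z, |g i z - g j z| ≤ |t i z - t j z|) :
    ∫⁻ z, ENNReal.ofReal (expMax fun i => a i + ∫ w, g i w ∂μ - g i z) ∂μ ≤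
      ∫⁻ z, ENNReal.ofReal
        ((expMax (fun i => a i + 2 * t i z) + expMax (fun i => a i - 2 * t i z)) / 2) ∂μ := by
  obtain ⟨A, hA⟩ : ∃ A, ∀ i, a i ≤ A :=
    ⟨Finset.univ.sup' Finset.univ_nonempty a, fun i => Finset.le_sup' a (Finset.mem_univ i)⟩
  have hgi : ∀ i, Integrable (g i) μ := fun i =>
    Integrable.of_bound (hg i).aestronglyMeasurable B (Eventually.of_forall fun z => hB i z)
  have hint : ∀ i, ∫ w, g i w ∂μ ≤ B := fun i => by
    have := integral_mono (hgi i) (integrable_const B) fun z => (abs_le.1 (hB i z)).2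
    simpa using this
  have i1 : Integrable (fun z => expMax fun i => a i + ∫ w, g i w ∂μ - g i z) μ :=
    integrable_expMax (B := A + B + B) (fun i => by have := hg i; fun_prop) fun i z => by
      have := (abs_le.1 (hB i z)).1
      linarith [hA i, hint i]
  have i2 : Integrable (fun z => expMax fun i => a i - 2 * g i z) μ :=
    integrable_expMax (B := A + 2 * B) (fun i => by have := hg i; fun_prop) fun i z => by
      have := (abs_le.1 (hB i z)).1
      linarith [hA i]
  have i3 : Integrable (fun z => expMax fun i => a i + 2 * g i z) μ :=
    integrable_expMax (B := A + 2 * B) (fun i => by have := hg i; fun_prop) fun i z => by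
      have := (abs_le.1 (hB i z)).2
      linarith [hA i]
  have jensen : expMax (fun i => a i + 2 * ∫ w, g i w ∂μ) ≤
      ∫ z, expMax (fun i => a i + 2 * g i z) ∂μ := by
    refine expMax_le_of_forall fun i => ?_
    have ie : Integrable (fun z => Real.exp (a i + 2 * g i z)) μ := by
      refine Integrable.of_bound (by have := hg i; fun_prop) (Real.exp (A + 2 * B))
        (Eventually.of_forall fun z => ?_)
      rw [Real.norm_of_nonneg (Real.exp_pos _).le]
      have := (abs_le.1 (hB i z)).2
      exact Real.exp_le_exp.2 (by linarith [hA i])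
    have h1 := convexOn_exp.map_integral_le (μ := μ) (f := fun z => a i + 2 * g i z)
      Real.continuous_exp.continuousOn isClosed_univ (Eventually.of_forall fun _ => Set.mem_univ _)
      ((integrable_const _).add ((hgi i).const_mul 2)) ie
    rw [integral_add (integrable_const _) ((hgi i).const_mul 2), integral_const,
      integral_const_mul] at h1
    simp only [probReal_univ, one_smul] at h1
    exact h1.trans (integral_mono ie i3 fun z => exp_le_expMax (fun i => a i + 2 * g i z) i)
  rw [← ofReal_integral_eq_lintegral_ofReal i1 (Eventually.of_forall fun z => (expMax_pos _).le)]
  calc ENNReal.ofReal (∫ z, expMax (fun i => a i + ∫ w, g i w ∂μ - g i z) ∂μ)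
      ≤ ENNReal.ofReal (∫ z, (expMax (fun i => a i + 2 * g i z) +
          expMax (fun i => a i - 2 * g i z)) / 2 ∂μ) := by
        refine ENNReal.ofReal_le_ofReal ?_
        rw [integral_div, integral_add i3 i2]
        have := integral_mono i1 (((integrable_const
          (expMax fun i => a i + 2 * ∫ w, g i w ∂μ)).add i2).div_const 2) fun z =>
            expMax_add_sub_le a (fun i => ∫ w, g i w ∂μ) (fun i => g i z)
        simp only [Pi.add_apply] at this
        rw [integral_div, integral_add (integrable_const _) i2, integral_const] at this
        simp only [probReal_univ, one_smul] at this
        linarith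
    _ = ∫⁻ z, ENNReal.ofReal ((expMax (fun i => a i + 2 * g i z) +
          expMax (fun i => a i - 2 * g i z)) / 2) ∂μ :=
        ofReal_integral_eq_lintegral_ofReal ((i3.add i2).div_const 2)
          (Eventually.of_forall fun z => div_nonneg (add_pos (expMax_pos _) (expMax_pos _)).le
            zero_le_two)
    _ ≤ _ := by
        refine lintegral_mono fun z => ENNReal.ofReal_le_ofReal ?_
        refine div_le_div_of_nonneg_right ?_ zero_le_two
        refine expMax_contraction a (fun i => 2 * g i z) (fun i => 2 * t i z) (fun i => ?_)
          fun i j => ?_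
        · rw [abs_mul, abs_mul]
          exact mul_le_mul_of_nonneg_left (hgt i z) (abs_nonneg _)
        · rw [← mul_sub, ← mul_sub, abs_mul, abs_mul]
          exact mul_le_mul_of_nonneg_left (hlip i j z) (abs_nonneg _)

end ExpMax

/-! ### Exponential moments and tail bound for the empirical process. -/

/-- Duality of `ℓ₁` and `ℓ∞` reduces to the largest coordinate, and that maximum is dominated by a
sum. The hyperbolic cosine is chosen because averaging over a random sign reproduces it up to a
factor. -/
lemma exp_sum_mul_le {J : Type*} [Fintype J] [Nonempty J] {R : ℝ} (hR : 0 ≤ R) (d v : J → ℝ)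
    (hd : ∑ j, |d j| ≤ R) :
    Real.exp (∑ j, d j * v j) ≤ ∑ j, 2 * Real.cosh (R * v j) := by
  obtain ⟨k, -, hk⟩ := Finset.exists_max_image Finset.univ (fun j => |v j|) Finset.univ_nonempty
  have h1 : ∑ j, d j * v j ≤ R * |v k| := by
    calc ∑ j, d j * v j ≤ ∑ j, |d j| * |v k| := by
          refine Finset.sum_le_sum fun j hj => (le_abs_self _).trans ?_
          rw [abs_mul]
          exact mul_le_mul_of_nonneg_left (hk j hj) (abs_nonneg _)
      _ = (∑ j, |d j|) * |v k| := by rw [Finset.sum_mul]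
      _ ≤ _ := mul_le_mul_of_nonneg_right hd (abs_nonneg _)
  have h2 : Real.exp (R * |v k|) ≤ 2 * Real.cosh (R * v k) := by
    rw [← Real.cosh_abs, abs_mul, abs_of_nonneg hR, Real.cosh_eq]
    linarith [Real.exp_pos (-(R * |v k|))]
  exact (Real.exp_le_exp.2 h1).trans (h2.trans
    (Finset.single_le_sum (f := fun j => 2 * Real.cosh (R * v j))
      (fun j _ => mul_nonneg zero_le_two (Real.cosh_pos _).le) (Finset.mem_univ k)))

/-- The average equals `2 cosh x cosh y`, and `cosh y ≤ exp (y² / 2)`. This is the cost of one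
symmetrized observation. -/
lemma cosh_add_add_cosh_sub_le {x y R : ℝ} (hy : |y| ≤ R) :
    (2 * Real.cosh (x + y) + 2 * Real.cosh (x - y)) / 2 ≤
      2 * Real.cosh x * Real.exp (R ^ 2 / 2) := by
  rw [Real.cosh_add, Real.cosh_sub]
  have h1 : Real.cosh y ≤ Real.exp (R ^ 2 / 2) :=
    (Real.cosh_le_exp_half_sq y).trans (Real.exp_le_exp.2
      (div_le_div_of_nonneg_right (sq_le_sq' (abs_le.1 hy).1 (abs_le.1 hy).2) zero_le_two))
  nlinarith [mul_nonneg (Real.cosh_pos x).le (sub_nonneg.2 h1)]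

/-- Exponential moment of the centred empirical process indexed by a finite set, for a Lipschitz
image of linear combinations with coefficients in an `ℓ₁`-ball. -/
lemma lintegral_expMax_pi_le {ι J Z : Type*} [Fintype ι] [Nonempty ι] [Fintype J] [Nonempty J]
    [MeasurableSpace Z] {R B : ℝ} (hR : 0 ≤ R) (δ : ι → J → ℝ)
    (hδ : ∀ i, ∑ j, |δ i j| ≤ R) (h : J → Z → ℝ) (hh : ∀ j, Measurable (h j))
    (hB : ∀ j z, |h j z| ≤ B) (g : ι → Z → ℝ) (hg : ∀ i, Measurable (g i))
    (hgt : ∀ i z, |g i z| ≤ |∑ j, δ i j * h j z|)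
    (hlip : ∀ i k z, |g i z - g k z| ≤ |∑ j, δ i j * h j z - ∑ j, δ k j * h j z|)
    (n : ℕ) (μ : Fin n → Measure Z) [∀ k, IsProbabilityMeasure (μ k)] (v : J → ℝ) :
    ∫⁻ z, ENNReal.ofReal (expMax fun i =>
        ∑ j, δ i j * v j + ∑ k, (∫ w, g i w ∂(μ k) - g i (z k))) ∂(Measure.pi μ) ≤
      ENNReal.ofReal ((∑ j, 2 * Real.cosh (R * v j)) * Real.exp ((2 * R * B) ^ 2 / 2) ^ n) := by
  have hgB : ∀ i z, |g i z| ≤ R * B := fun i z => by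
    have hB0 : 0 ≤ B := (abs_nonneg _).trans (hB (Classical.arbitrary J) z)
    calc |g i z| ≤ |∑ j, δ i j * h j z| := hgt i z
      _ ≤ ∑ j, |δ i j| * B := by
        refine (Finset.abs_sum_le_sum_abs _ _).trans (Finset.sum_le_sum fun j _ => ?_)
        rw [abs_mul]
        exact mul_le_mul_of_nonneg_left (hB j z) (abs_nonneg _)
      _ ≤ R * B := by
        rw [← Finset.sum_mul]
        exact mul_le_mul_of_nonneg_right (hδ i) hB0
  -- The offset `v` must be free: it collects the linear terms `± 2 h j` of the observations already
  -- symmetrized.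
  induction n generalizing v with
  | zero =>
    simp only [Finset.univ_eq_empty, Finset.sum_empty, add_zero, pow_zero, mul_one,
      lintegral_const, measure_univ]
    exact ENNReal.ofReal_le_ofReal (expMax_le_of_forall fun i => exp_sum_mul_le hR _ _ (hδ i))
  | succ n ih =>
    have split : ∀ F : (Fin (n + 1) → Z) → ENNReal, Measurable F →
        ∫⁻ z, F z ∂(Measure.pi μ) =
          ∫⁻ y, ∫⁻ x, F (Fin.cons x y) ∂(μ 0) ∂(Measure.pi fun k : Fin n => μ k.succ) := by
      intro F hF
      have mp := (measurePreserving_piFinSuccAbove μ 0).symm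
      simp only [Fin.zero_succAbove] at mp
      have e : ∀ x y, (MeasurableEquiv.piFinSuccAbove (fun _ => Z) 0).symm (x, y) =
          (Fin.cons x y : Fin (n + 1) → Z) := fun x y => by
        simp [MeasurableEquiv.piFinSuccAbove_symm_apply, Fin.insertNthEquiv]
      rw [← mp.lintegral_comp hF]
      refine (lintegral_prod_symm' (fun a => F ((MeasurableEquiv.piFinSuccAbove
        (fun _ => Z) 0).symm a)) (hF.comp mp.measurable)).trans ?_
      simp only [e]
    have meas : ∀ c : ι → ℝ, Measurable fun y : Fin n → Z => ENNReal.ofReal (expMax fun i =>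
        c i + ∑ k, (∫ w, g i w ∂(μ k.succ) - g i (y k))) := fun c =>
      (measurable_expMax fun i => by fun_prop).ennreal_ofReal
    rw [split _ (measurable_expMax fun i => by fun_prop).ennreal_ofReal]
    have half : ∀ x y : ℝ, 0 ≤ x → 0 ≤ y → ENNReal.ofReal ((x + y) / 2) =
        ENNReal.ofReal (1 / 2) * (ENNReal.ofReal x + ENNReal.ofReal y) := fun x y hx hy => by
      rw [← ENNReal.ofReal_add hx hy, ← ENNReal.ofReal_mul (by norm_num)]
      congr 1
      ring
    set E := Real.exp ((2 * R * B) ^ 2 / 2) with hE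
    have hE0 : 0 ≤ E := (Real.exp_pos _).le
    calc _ ≤ ∫⁻ y, ∫⁻ x, ENNReal.ofReal (1 / 2) * (
            ENNReal.ofReal (expMax fun i => ∑ j, δ i j * (v j + 2 * h j x) +
              ∑ k : Fin n, (∫ w, g i w ∂(μ k.succ) - g i (y k))) +
            ENNReal.ofReal (expMax fun i => ∑ j, δ i j * (v j - 2 * h j x) +
              ∑ k : Fin n, (∫ w, g i w ∂(μ k.succ) - g i (y k))))
            ∂(μ 0) ∂(Measure.pi fun k : Fin n => μ k.succ) := by
          refine lintegral_mono fun y => ?_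
          have := lintegral_expMax_le (μ 0) (fun i => ∑ j, δ i j * v j +
            ∑ k : Fin n, (∫ w, g i w ∂(μ k.succ) - g i (y k))) g
            (fun i z => ∑ j, δ i j * h j z) hg hgB hgt hlip
          simp only [Fin.sum_univ_succ, Fin.cons_zero, Fin.cons_succ]
          refine le_trans (le_of_eq ?_) (this.trans (le_of_eq ?_))
          · refine lintegral_congr fun x => ?_
            congr 2
            ext i
            ring
          · refine lintegral_congr fun x => ?_
            rw [half _ _ (expMax_pos _).le (expMax_pos _).le]
            congr 4 <;> ext i <;>
              simp only [mul_add, mul_sub, Finset.sum_add_distrib, Finset.sum_sub_distrib,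
                Finset.mul_sum, mul_left_comm (2 : ℝ)] <;> ring
      -- Tonelli: with the first observation `x` fixed, the inner integral is the case of `n`
      -- observations with offset `v ± 2 h j x`.
      _ = ∫⁻ x, ∫⁻ y, ENNReal.ofReal (1 / 2) * (
            ENNReal.ofReal (expMax fun i => ∑ j, δ i j * (v j + 2 * h j x) +
              ∑ k : Fin n, (∫ w, g i w ∂(μ k.succ) - g i (y k))) +
            ENNReal.ofReal (expMax fun i => ∑ j, δ i j * (v j - 2 * h j x) +
              ∑ k : Fin n, (∫ w, g i w ∂(μ k.succ) - g i (y k))))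
            ∂(Measure.pi fun k : Fin n => μ k.succ) ∂(μ 0) := by
          refine lintegral_lintegral_swap (Measurable.aemeasurable ?_)
          simp only [Function.uncurry_def]
          refine Measurable.const_mul (Measurable.fun_add ?_ ?_) _ <;>
            exact (measurable_expMax fun i => by fun_prop).ennreal_ofReal
      _ ≤ ∫⁻ x, ENNReal.ofReal ((∑ j, 2 * Real.cosh (R * v j)) * E ^ (n + 1)) ∂(μ 0) := by
          refine lintegral_mono fun x => ?_
          simp only
          rw [lintegral_const_mul _ ((meas fun i => ∑ j, δ i j * (v j + 2 * h j x)).fun_add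
            (meas fun i => ∑ j, δ i j * (v j - 2 * h j x))),
            lintegral_add_left (meas fun i => ∑ j, δ i j * (v j + 2 * h j x))]
          refine (mul_le_mul_right (add_le_add (ih (fun k => μ k.succ) fun j => v j + 2 * h j x)
            (ih (fun k => μ k.succ) fun j => v j - 2 * h j x)) _).trans ?_
          rw [← half]
          · refine ENNReal.ofReal_le_ofReal ?_
            rw [← add_mul, mul_div_right_comm, pow_succ', ← mul_assoc]
            refine mul_le_mul_of_nonneg_right ?_ (pow_nonneg hE0 n)
            rw [← Finset.sum_add_distrib, Finset.sum_div, Finset.sum_mul]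
            refine Finset.sum_le_sum fun j _ => ?_
            rw [mul_add, mul_sub]
            refine cosh_add_add_cosh_sub_le ?_
            rw [abs_mul, abs_mul, abs_of_nonneg hR, abs_two]
            nlinarith [mul_le_mul_of_nonneg_left (hB j x) hR]
          all_goals
            exact mul_nonneg (Finset.sum_nonneg fun j _ =>
              mul_nonneg zero_le_two (Real.cosh_pos _).le) (pow_nonneg hE0 n)
      _ = _ := by simp

/-- A tail bound for the supremum of the centred empirical process over a finite index set. -/
lemma measure_exists_le_of_lipschitz {Ω : Type*} [MeasurableSpace Ω] {P : Measure Ω}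
    [IsProbabilityMeasure P]
    {ι J Z : Type*} [Fintype ι] [Nonempty ι] [Fintype J] [Nonempty J]
    [MeasurableSpace Z] {R B : ℝ} (hR : 0 ≤ R) (δ : ι → J → ℝ)
    (hδ : ∀ i, ∑ j, |δ i j| ≤ R) (h : J → Z → ℝ) (hh : ∀ j, Measurable (h j))
    (hB : ∀ j z, |h j z| ≤ B) (g : ι → Z → ℝ) (hg : ∀ i, Measurable (g i))
    (hgt : ∀ i z, |g i z| ≤ |∑ j, δ i j * h j z|)
    (hlip : ∀ i k z, |g i z - g k z| ≤ |∑ j, δ i j * h j z - ∑ j, δ k j * h j z|)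
    {n : ℕ} (W : Fin n → Ω → Z) (hW : ∀ k, Measurable (W k)) (hind : iIndepFun W P) (s : ℝ) :
    P {ω | ∃ i, s ≤ ∑ k, (∫ ω', g i (W k ω') ∂P - g i (W k ω))} ≤
      ENNReal.ofReal (2 * Fintype.card J * Real.exp (n * ((2 * R * B) ^ 2 / 2) - s)) := by
  have hmap := hind.map_fun_eq_pi_map fun k => (hW k).aemeasurable
  have (k : Fin n) : IsProbabilityMeasure (P.map (W k)) :=
    Measure.isProbabilityMeasure_map (hW k).aemeasurable
  have hmgf := lintegral_expMax_pi_le hR δ hδ h hh hB g hg hgt hlip n (fun k => P.map (W k)) 0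
  have hW' : Measurable fun ω k => W k ω := measurable_pi_lambda _ hW
  have hmeas : Measurable fun z : Fin n → Z => ENNReal.ofReal (expMax fun i =>
      ∑ j, δ i j * (0 : J → ℝ) j + ∑ k, (∫ w, g i w ∂(P.map (W k)) - g i (z k))) :=
    (measurable_expMax fun i => by fun_prop).ennreal_ofReal
  rw [← hmap, lintegral_map hmeas hW'] at hmgf
  have hI : ∀ i k, ∫ w, g i w ∂(P.map (W k)) = ∫ ω', g i (W k ω') ∂P := fun i k =>
    integral_map (hW k).aemeasurable (hg i).aestronglyMeasurable
  simp only [Pi.zero_apply, mul_zero, Finset.sum_const_zero, zero_add, Real.cosh_zero, mul_one,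
    Finset.sum_const, Finset.card_univ, nsmul_eq_mul, hI] at hmgf
  have hsub : {ω | ∃ i, s ≤ ∑ k, (∫ ω', g i (W k ω') ∂P - g i (W k ω))} ⊆
      {ω | ENNReal.ofReal (Real.exp s) ≤ ENNReal.ofReal (expMax fun i =>
        ∑ k, (∫ ω', g i (W k ω') ∂P - g i (W k ω)))} := by
    rintro ω ⟨i, hi⟩
    exact ENNReal.ofReal_le_ofReal ((Real.exp_le_exp.2 hi).trans (exp_le_expMax
      (fun i => ∑ k, (∫ ω', g i (W k ω') ∂P - g i (W k ω))) i))
  -- Markov's inequality for the exponential moment at offset `0`, where each of the hyperbolic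
  -- cosines equals `1`.
  refine (measure_mono hsub).trans ?_
  refine (meas_ge_le_lintegral_div (measurable_expMax fun i => by
    fun_prop).ennreal_ofReal.aemeasurable ?_ ENNReal.ofReal_ne_top).trans ?_
  · simpa using Real.exp_pos s
  · refine (ENNReal.div_le_div_right hmgf _).trans (le_of_eq ?_)
    rw [← ENNReal.ofReal_div_of_pos (Real.exp_pos s), Real.exp_sub, Real.exp_nat_mul]
    congr 1
    ring

/-! ### Norms of coefficient vectors, the tuning rule and the conjugate of the quadratic margin. -/

section Vectors

variable {p : ℕ}

lemma l1_nonneg (β : Fin p → ℝ) : 0 ≤ l1 β := Finset.sum_nonneg fun _ _ => abs_nonneg _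

lemma l2_nonneg (β : Fin p → ℝ) : 0 ≤ l2 β := Real.sqrt_nonneg _

lemma l2_sq (β : Fin p → ℝ) : l2 β ^ 2 = ∑ j, β j ^ 2 :=
  Real.sq_sqrt (Finset.sum_nonneg fun _ _ => sq_nonneg _)

lemma l1_smul (t : ℝ) (β : Fin p → ℝ) : l1 (t • β) = |t| * l1 β := by
  simp [l1, abs_mul, Finset.mul_sum]

lemma l2_eq_zero {β : Fin p → ℝ} (h : l2 β = 0) : β = 0 := by
  have h0 : ∑ j, β j ^ 2 = 0 := by rw [← l2_sq, h]; ring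
  rw [Finset.sum_eq_zero_iff_of_nonneg fun _ _ => sq_nonneg _] at h0
  ext j
  simpa using h0 j (Finset.mem_univ j)

lemma l2_pos {β : Fin p → ℝ} (h : β ≠ 0) : 0 < l2 β :=
  (l2_nonneg β).lt_of_ne fun h0 => h (l2_eq_zero h0.symm)

lemma l1_restrict (S : Finset (Fin p)) (β : Fin p → ℝ) : l1 (restrict S β) = ∑ j ∈ S, |β j| := by
  simp [l1, restrict, apply_ite abs, Finset.sum_ite_mem]

lemma l2_restrict_sq (S : Finset (Fin p)) (β : Fin p → ℝ) :
    l2 (restrict S β) ^ 2 = ∑ j ∈ S, β j ^ 2 := by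
  simp [l2_sq, restrict, ite_pow, Finset.sum_ite_mem]

lemma l1_eq_restrict_add (S : Finset (Fin p)) (β : Fin p → ℝ) :
    l1 β = l1 (restrict S β) + l1 (restrict Sᶜ β) := by
  rw [l1_restrict, l1_restrict, Finset.sum_add_sum_compl, l1]

lemma l1_restrict_le (S : Finset (Fin p)) (β : Fin p → ℝ) :
    l1 (restrict S β) ≤ √(S.card : ℝ) * l2 (restrict S β) := by
  refine abs_le_of_sq_le_sq' ?_ (mul_nonneg (Real.sqrt_nonneg _) (l2_nonneg _)) |>.2
  rw [mul_pow, Real.sq_sqrt (Nat.cast_nonneg _), l2_restrict_sq, l1_restrict]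
  simpa using sq_sum_le_card_mul_sum_sq (s := S) (f := fun j => |β j|)

lemma mem_supp {β : Fin p → ℝ} {j : Fin p} : j ∈ supp β ↔ β j ≠ 0 := by simp [supp]

lemma restrict_supp (β : Fin p → ℝ) : restrict (supp β) β = β := by
  ext j
  by_cases h : β j = 0 <;> simp [restrict, mem_supp, h]

lemma supp_nonempty {β : Fin p → ℝ} : (supp β).Nonempty ↔ β ≠ 0 := by
  rw [Function.ne_iff]
  exact exists_congr fun j => mem_supp

/-- Off the support of `b` the difference is exactly `-|δ j|`; on it the triangle inequality
applies. -/
lemma l1_sub_l1_add_le (b δ : Fin p → ℝ) :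
    l1 b - l1 (b + δ) ≤ l1 (restrict (supp b) δ) - l1 (restrict (supp b)ᶜ δ) := by
  simp only [l1, ← Finset.sum_sub_distrib]
  refine Finset.sum_le_sum fun j _ => ?_
  by_cases h : b j = 0
  · simp [restrict, mem_supp, h]
  · have := abs_sub (b j + δ j) (δ j)
    simp only [add_sub_cancel_right] at this
    simp [restrict, mem_supp, h]
    linarith

lemma sum_mul_ge_neg (b δ : Fin p → ℝ) :
    -(l2 b * l2 (restrict (supp b) δ)) ≤ ∑ j, b j * δ j := by
  have h1 : ∑ j, b j * δ j = ∑ j ∈ supp b, b j * δ j := by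
    refine (Finset.sum_subset (Finset.subset_univ _) fun j _ hj => ?_).symm
    simp [not_not.1 (mem_supp.not.1 hj)]
  have h2 := Finset.sum_mul_sq_le_sq_mul_sq (supp b) b δ
  rw [h1]
  refine (abs_le_of_sq_le_sq' ?_ (mul_nonneg (l2_nonneg _) (l2_nonneg _))).1
  rw [mul_pow, ← l2_restrict_sq, ← l2_restrict_sq, restrict_supp] at *
  exact h2

/-- The square is expanded and `-‖δ‖₂²` dropped. The cross term sees only the support of `b`, where
Cauchy-Schwarz applies. -/
lemma l2_sq_sub_l2_add_sq_le (b δ : Fin p → ℝ) :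
    l2 b ^ 2 - l2 (b + δ) ^ 2 ≤ 2 * l2 b * l2 (restrict (supp b) δ) := by
  have h : l2 b ^ 2 - l2 (b + δ) ^ 2 = - 2 * (∑ j, b j * δ j) - ∑ j, δ j ^ 2 := by
    rw [l2_sq, l2_sq, Finset.mul_sum, ← Finset.sum_sub_distrib, ← Finset.sum_sub_distrib]
    exact Finset.sum_congr rfl fun j _ => by simp only [Pi.add_apply]; ring
  have h2 := sum_mul_ge_neg b δ
  have h3 : 0 ≤ ∑ j, δ j ^ 2 := Finset.sum_nonneg fun _ _ => sq_nonneg _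
  linarith

/-- The tuning balances the penalties: the ridge term contributes the same `λ₁ √s` as the `ℓ₁` term,
whatever the size of `β`. -/
lemma tunedLambda2_mul_l2 (lam1 : ℝ) {β : Fin p → ℝ} (hβ : β ≠ 0) :
    2 * tunedLambda2 lam1 β * l2 β = lam1 * √((supp β).card : ℝ) := by
  have := (l2_pos hβ).ne'
  rw [tunedLambda2]
  field_simp

lemma convexConjugate_sq {c : ℝ} (hc : 0 < c) {v : ℝ} (hv : 0 ≤ v) :
    convexConjugate (fun u => c * u ^ 2) v = v ^ 2 / (4 * c) := by
  -- The supremum is attained at the critical point `u = v / (2c)`.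
  refine IsGreatest.csSup_eq ⟨⟨v / (2 * c), Set.mem_Ici.2 (by positivity), ?_⟩, ?_⟩
  · field_simp
    ring
  · rintro _ ⟨u, -, rfl⟩
    rw [le_div_iff₀ (by positivity)]
    nlinarith [sq_nonneg (v - 2 * c * u)]

lemma convexOn_l1 : ConvexOn ℝ Set.univ (l1 : (Fin p → ℝ) → ℝ) := by
  refine ⟨convex_univ, fun x _ y _ r s hr hs _ => ?_⟩
  simp only [l1, smul_eq_mul, Finset.mul_sum, ← Finset.sum_add_distrib]
  refine Finset.sum_le_sum fun j _ => ?_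
  simpa [abs_mul, abs_of_nonneg hr, abs_of_nonneg hs] using abs_add_le (r * x j) (s * y j)

lemma convexOn_l2_sq : ConvexOn ℝ Set.univ (fun β : Fin p → ℝ => l2 β ^ 2) := by
  refine ⟨convex_univ, fun x _ y _ r s hr hs hrs => ?_⟩
  simp only [l2_sq, smul_eq_mul, Finset.mul_sum, ← Finset.sum_add_distrib]
  refine Finset.sum_le_sum fun j _ => ?_
  simp only [Pi.add_apply, Pi.smul_apply, smul_eq_mul]
  obtain rfl : s = 1 - r := by linarith
  nlinarith [mul_nonneg (mul_nonneg hr hs) (sq_nonneg (x j - y j))]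

end Vectors

/-! ### The deterministic oracle inequality. -/

namespace Model

variable {Ω : Type u} [MeasurableSpace Ω] {P : Measure Ω} {n : ℕ} (M : Model.{u, v} P n)

lemma lin_add (β β' : Fin M.p → ℝ) : M.lin (β + β') = M.lin β + M.lin β' := by
  simp [lin, add_smul, Finset.sum_add_distrib]

lemma lin_smul (t : ℝ) (β : Fin M.p → ℝ) : M.lin (t • β) = t • M.lin β := by
  simp [lin, Finset.smul_sum, mul_smul]

lemma lin_sub (β β' : Fin M.p → ℝ) : M.lin (β - β') = M.lin β - M.lin β' := by
  rw [sub_eq_add_neg, ← neg_one_smul ℝ β', lin_add, lin_smul]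
  module

lemma lin_apply (β : Fin M.p → ℝ) (x : M.XSpace) :
    (M.lin β : M.XSpace → ℝ) x = ∑ j, β j * (M.ψ j : M.XSpace → ℝ) x := by
  simp [lin]

lemma convexOn_criterion {lam1 lam2 : ℝ} (h1 : 0 ≤ lam1) (h2 : 0 ≤ lam2) (ω : Ω) :
    ConvexOn ℝ Set.univ (M.criterion lam1 lam2 ω) := by
  have he : ConvexOn ℝ Set.univ fun β : Fin M.p → ℝ => M.empRisk (M.lin β) ω := by
    refine ⟨convex_univ, fun x _ y _ r s hr hs hrs => ?_⟩
    have := Finset.sum_le_sum fun i (_ : i ∈ Finset.univ) =>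
      (M.convex_ρ (M.X i ω, M.Y i ω)).2 (Set.mem_univ (M.lin x)) (Set.mem_univ (M.lin y)) hr hs hrs
    simp only [smul_eq_mul, Finset.sum_add_distrib, ← Finset.mul_sum] at this
    simp only [empRisk, lin_add, lin_smul, smul_eq_mul]
    have h0 : (0 : ℝ) ≤ 1 / n := by positivity
    calc _ ≤ 1 / (n : ℝ) * _ := mul_le_mul_of_nonneg_left this h0
      _ = _ := by ring
  exact (he.add (convexOn_l1.smul h1)).add (convexOn_l2_sq.smul h2)

lemma phiSq_le {lam1 lam2 : ℝ} {b : Fin M.p → ℝ} {S : Finset (Fin M.p)} {δ : Fin M.p → ℝ}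
    (hδ : δ ≠ 0) (h : l1 (restrict Sᶜ δ) ≤
      3 * (√(S.card : ℝ) + 2 * lam2 * l2 (restrict S b) / lam1) * l2 (restrict S δ)) :
    M.phiSq lam1 lam2 b S ≤ M.N (M.lin δ) ^ 2 / l2 (restrict S δ) ^ 2 := by
  refine csInf_le ⟨0, ?_⟩ ⟨δ, hδ, h, rfl⟩
  rintro _ ⟨β, -, -, rfl⟩
  positivity

/-- The reference vector enters only through `λ₂ ‖b_S‖₂`, a product that the tuning rule fixes once
the support is given. -/
lemma phiSq_congr {lam1 lam2 lam2' : ℝ} {b b' : Fin M.p → ℝ} {S : Finset (Fin M.p)}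
    (h : 2 * lam2 * l2 (restrict S b) = 2 * lam2' * l2 (restrict S b')) :
    M.phiSq lam1 lam2 b S = M.phiSq lam1 lam2' b' S := by
  rw [phiSq, phiSq, h]

/-- On a linear target the tuned oracle is the target itself. -/
lemma eq_of_isTunedOracle {c η lam1 lam2 φ₀ : ℝ} (hc : 0 < c) {f₀ : M.F}
    {β₀ b : Fin M.p → ℝ} (hf₀ : f₀ = M.lin β₀) (hβ₀ : β₀ ≠ 0)
    (hmargin : M.MarginCondition f₀ η (fun u => c * u ^ 2))
    (horacle : M.IsTunedOracle f₀ (fun u => c * u ^ 2) lam1 {supp β₀} b)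
    (hloc : M.lin b ∈ M.localSet f₀ η) (hφ₀ : 0 < φ₀)
    (hφ : φ₀ ≤ M.phiSq lam1 lam2 b (supp β₀)) (hlam : 0 ≤ lam2 / lam1) : b = β₀ := by
  obtain ⟨hs, hmin⟩ := horacle
  rw [Set.mem_singleton_iff] at hs
  have hb : b ≠ 0 := supp_nonempty.1 (hs ▸ supp_nonempty.2 hβ₀)
  have htun : 2 * tunedLambda2 lam1 b * l2 b = 2 * tunedLambda2 lam1 β₀ * l2 β₀ := by
    rw [tunedLambda2_mul_l2 _ hb, tunedLambda2_mul_l2 _ hβ₀, hs]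
  have hphi : M.phiSq lam1 (tunedLambda2 lam1 b) b (supp b) =
      M.phiSq lam1 (tunedLambda2 lam1 β₀) β₀ (supp β₀) := by
    rw [hs]
    refine M.phiSq_congr ?_
    rw [restrict_supp, ← hs, restrict_supp, htun]
  -- The conjugate terms of `b` and `β₀` coincide and cancel, so the excess risk of `b` is at most
  -- that of the target, namely `0`.
  have h1 := hmin β₀ rfl
  rw [oracleObjective, oracleObjective, hphi, hs, mul_assoc 4 (tunedLambda2 lam1 b),
    mul_assoc 4 (tunedLambda2 lam1 β₀), show tunedLambda2 lam1 b * l2 b =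
      tunedLambda2 lam1 β₀ * l2 β₀ by linarith, ← hf₀] at h1
  have h0 : M.excessRisk f₀ f₀ = 0 := sub_self _
  have h2 := hmargin _ hloc
  have h3 : c * M.N (M.lin b - f₀) ^ 2 ≤ 0 := by linarith
  have h4 : M.N (M.lin b - f₀) ^ 2 ≤ 0 := nonpos_of_mul_nonpos_right h3 hc
  -- The vector `b - β₀` vanishes off `supp β₀`, so it lies in the cone. If it were nonzero, its
  -- zero seminorm would force the eigenvalue to be at most `0`.
  by_contra hne
  have h5 := M.phiSq_le (lam1 := lam1) (lam2 := lam2) (b := b) (S := supp β₀)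
    (sub_ne_zero.2 hne) (by
      have hz : l1 (restrict (supp β₀)ᶜ (b - β₀)) = 0 := by
        rw [l1_restrict]
        refine Finset.sum_eq_zero fun j hj => ?_
        have hj0 := Finset.mem_compl.1 hj
        have e1 : β₀ j = 0 := not_not.1 (mem_supp.not.1 hj0)
        have e2 : b j = 0 := not_not.1 (mem_supp.not.1 (hs ▸ hj0))
        simp [e1, e2]
      rw [hz]
      refine mul_nonneg (mul_nonneg (by norm_num) (add_nonneg (Real.sqrt_nonneg _) ?_))
        (l2_nonneg _)
      rw [show 2 * lam2 * l2 (restrict (supp β₀) b) / lam1 =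
        2 * (lam2 / lam1) * l2 (restrict (supp β₀) b) by ring]
      have := l2_nonneg (restrict (supp β₀) b)
      positivity)
  rw [lin_sub, ← hf₀, le_antisymm h4 (sq_nonneg _), zero_div] at h5
  linarith

/-- The excess risk is `0` at the target and the tuned argument of `H` is `v = 6 λ₁ √s / φ`. Then `H
v = v² / (4c)` produces the constant `9 = 36 / 4`. -/
lemma delta_eq {c lam1 lam2 : ℝ} (hc : 0 < c) (hlam : 0 ≤ lam1) {f₀ : M.F} {b : Fin M.p → ℝ}
    (hf₀ : f₀ = M.lin b) (htun : 2 * lam2 * l2 b = lam1 * √((supp b).card : ℝ))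
    (hφ : 0 < M.phiSq lam1 lam2 b (supp b)) :
    M.Delta f₀ (fun u => c * u ^ 2) lam1 lam2 b =
      9 * lam1 ^ 2 * (supp b).card / (c * M.phiSq lam1 lam2 b (supp b)) := by
  have h0 : M.excessRisk f₀ f₀ = 0 := sub_self _
  rw [Delta, oracleObjective, ← hf₀, h0, show 4 * lam1 * √((supp b).card : ℝ) + 4 * lam2 * l2 b =
    6 * lam1 * √((supp b).card : ℝ) by linarith, convexConjugate_sq hc (by positivity), div_pow,
    mul_pow, Real.sq_sqrt (Nat.cast_nonneg _), Real.sq_sqrt hφ.le]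
  field_simp
  ring

/-- The bound on the localized estimator. -/
lemma l1_le_of_basic_inequality {c lam0 lam1 lam2 Δ : ℝ} (hc : 0 < c) (hlam0 : 0 < lam0)
    (hlam : 8 * lam0 ≤ lam1) {b δ : Fin M.p → ℝ}
    (htun : 2 * lam2 * l2 b = lam1 * √((supp b).card : ℝ))
    (hφ : 0 < M.phiSq lam1 lam2 b (supp b))
    (hΔ : Δ = 9 * lam1 ^ 2 * (supp b).card / (c * M.phiSq lam1 lam2 b (supp b)))
    {ξ : ℝ} (hξ : c * M.N (M.lin δ) ^ 2 ≤ ξ)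
    (hbasic : ξ + lam1 * l1 (restrict (supp b)ᶜ δ) ≤
      Δ + 2 * lam1 * √((supp b).card : ℝ) * l2 (restrict (supp b) δ)) :
    l1 δ ≤ Δ / lam0 / 2 := by
  set S := supp b with hS
  set r := M.phiSq lam1 lam2 b S with hr
  set w := l2 (restrict S δ) with hw
  have hlam1 : 0 < lam1 := by linarith
  have hw0 : 0 ≤ w := l2_nonneg _
  have hq0 : 0 ≤ √(S.card : ℝ) := Real.sqrt_nonneg _
  have hx := l1_restrict_le S δ
  have hΔ0 : 0 ≤ Δ := by rw [hΔ]; positivity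
  have hξ0 : 0 ≤ ξ := le_trans (by positivity) hξ
  have hsum := l1_eq_restrict_add S δ
  have hx' := mul_le_mul_of_nonneg_left hx hlam1.le
  have hmain : lam1 * l1 δ ≤ 2 * Δ := by
    -- If `3 λ₁ √s w ≤ Δ`, adding `λ₁ ‖δ_S‖₁ ≤ λ₁ √s w` to the basic inequality suffices. Otherwise
    -- `λ₁ ‖δ_{Sᶜ}‖₁ ≤ 5 λ₁ √s w`, so `δ` lies in the cone with constant `6 √s`.
    by_cases hcase : 3 * (lam1 * (√(S.card : ℝ) * w)) ≤ Δ
    · rw [hsum]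
      nlinarith
    · push Not at hcase
      have hw1 : w ≠ 0 := fun h => by
        rw [h] at hcase
        simp at hcase
        linarith
      have hδ : δ ≠ 0 := fun h => hw1 (by
        rw [hw, h]
        simp [l2, restrict])
      have hcone : lam1 * l1 (restrict Sᶜ δ) ≤ lam1 * (6 * √(S.card : ℝ) * w) := by nlinarith
      have hcone' := le_of_mul_le_mul_left hcone hlam1
      have h1 := M.phiSq_le (lam1 := lam1) (lam2 := lam2) (b := b) (S := S) hδ (by
        rw [hS, restrict_supp, htun, mul_div_cancel_left₀ _ hlam1.ne']
        linarith)
      rw [← hr, ← hw, le_div_iff₀ (by positivity)] at h1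
      -- Young's inequality by completing the square; the eigenvalue and margin conditions then
      -- absorb `c r w²` into `ξ`.
      have h2 : 3 * (lam1 * (√(S.card : ℝ) * w)) ≤ c * (r * w ^ 2) + Δ / 4 := by
        have hs : Δ = 9 * (lam1 * √(S.card : ℝ)) ^ 2 / (c * r) := by
          rw [hΔ, mul_pow, Real.sq_sqrt (Nat.cast_nonneg _), mul_assoc 9]
        set q := lam1 * √(S.card : ℝ)
        have hcr : 0 < c * r := mul_pos hc hφ
        rw [hs]
        have : c * (r * w ^ 2) + 9 * q ^ 2 / (c * r) / 4 - 3 * (q * w) =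
            (c * r * w - 3 * q / 2) ^ 2 / (c * r) := by
          field_simp
          ring
        have h0 : 0 ≤ (c * r * w - 3 * q / 2) ^ 2 / (c * r) := by positivity
        linarith [mul_assoc lam1 (√(S.card : ℝ)) w]
      have h3 := mul_le_mul_of_nonneg_left h1 hc.le
      rw [hsum]
      nlinarith
  have h8 : 8 * lam0 * l1 δ ≤ lam1 * l1 δ := mul_le_mul_of_nonneg_right hlam (l1_nonneg _)
  rw [div_div, le_div_iff₀ (by positivity)]
  nlinarith [l1_nonneg δ]

/-- The deterministic part of the oracle inequality: on the event that the increments of the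
empirical process around the target are small, the elastic net is close to the target. -/
lemma l1_elasticNet_sub_le {c η lam0 lam1 lam2 : ℝ} (hc : 0 < c) (hlam0 : 0 < lam0)
    (hlam : 8 * lam0 ≤ lam1) {f₀ : M.F} {b bhat : Fin M.p → ℝ} (hf₀ : f₀ = M.lin b)
    (hb : b ≠ 0) (hbΦ : b ∈ M.Φ) (htun : 2 * lam2 * l2 b = lam1 * √((supp b).card : ℝ))
    (hφ : 0 < M.phiSq lam1 lam2 b (supp b))
    (hmargin : M.MarginCondition f₀ η (fun u => c * u ^ 2))
    (hloc : M.LocalCondition f₀ η (fun u => c * u ^ 2) lam0 lam1 lam2 b) {ω : Ω}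
    (hbhat : M.IsElasticNet lam1 lam2 ω bhat)
    (hev : ∀ β ∈ M.Φ, l1 (β - b) ≤ M.Delta f₀ (fun u => c * u ^ 2) lam1 lam2 b / lam0 →
      (M.risk (M.lin β) - M.empRisk (M.lin β) ω) - (M.risk (M.lin b) - M.empRisk (M.lin b) ω) ≤
        M.Delta f₀ (fun u => c * u ^ 2) lam1 lam2 b) :
    l1 (bhat - b) ≤ M.Delta f₀ (fun u => c * u ^ 2) lam1 lam2 b / lam0 := by
  have hlam1 : 0 < lam1 := by linarith
  have hΔ := M.delta_eq hc hlam1.le hf₀ htun hφ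
  set Δ := M.Delta f₀ (fun u => c * u ^ 2) lam1 lam2 b with hΔdef
  have hcard : 0 < ((supp b).card : ℝ) := by
    exact_mod_cast Finset.card_pos.2 (supp_nonempty.2 hb)
  have hΔ0 : 0 < Δ := by rw [hΔ]; positivity
  have hR0 : 0 < Δ / lam0 := by positivity
  have hlam2 : 0 ≤ lam2 := by
    have h : 0 ≤ 2 * lam2 * l2 b := by rw [htun]; positivity
    have := l2_pos hb
    by_contra hneg
    push Not at hneg
    nlinarith
  set R := Δ / lam0 with hR
  set T := l1 (bhat - b) with hT
  have hT0 : 0 ≤ T := l1_nonneg _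
  -- This weight keeps `b + δ` within `R` of `b` however large `T` is, since `‖δ‖₁ = R T / (R + T)`.
  -- A bound `‖δ‖₁ ≤ R / 2` is then equivalent to `T ≤ R`.
  set t := R / (R + T) with ht
  have hRT : 0 < R + T := by linarith
  have ht0 : 0 ≤ t := by positivity
  have ht1 : t ≤ 1 := by rw [ht, div_le_one hRT]; linarith
  set δ := t • (bhat - b) with hδ
  have hbδ : b + δ = t • bhat + (1 - t) • b := by
    rw [hδ]; module
  have hmem : b + δ ∈ M.Φ := by
    rw [hbδ]
    exact M.convex_Φ hbhat.1 hbΦ ht0 (by linarith) (by ring)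
  have hδl1 : l1 δ = t * T := by rw [hδ, l1_smul, abs_of_nonneg ht0]
  have hδR : l1 δ ≤ R := by
    rw [hδl1, ht, div_mul_eq_mul_div, div_le_iff₀ hRT]
    nlinarith
  -- By convexity, the point between the minimizer and `b` does no worse than `b`.
  have hcrit : M.criterion lam1 lam2 ω (b + δ) ≤ M.criterion lam1 lam2 ω b := by
    rw [hbδ]
    have := (M.convexOn_criterion hlam1.le hlam2 ω).2 (Set.mem_univ bhat) (Set.mem_univ b) ht0
      (sub_nonneg.2 ht1) (by ring)
    simp only [smul_eq_mul] at this
    have h2 := mul_le_mul_of_nonneg_left (hbhat.2 b hbΦ) ht0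
    linarith
  have hproc := hev (b + δ) hmem (by rwa [add_sub_cancel_left])
  have hlocal : M.lin (b + δ) ∈ M.localSet f₀ η :=
    hloc.2 (b + δ) (by rwa [add_sub_cancel_left])
  have hξ := hmargin _ hlocal
  have hsub : M.lin (b + δ) - f₀ = M.lin δ := by rw [lin_add, hf₀, add_sub_cancel_left]
  have hrisk : M.risk f₀ = M.risk (M.lin b) := by rw [hf₀]
  simp only [hsub] at hξ
  have h1 := mul_le_mul_of_nonneg_left (l1_sub_l1_add_le b δ) hlam1.le
  have h2 := mul_le_mul_of_nonneg_left (l2_sq_sub_l2_add_sq_le b δ) hlam2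
  have h3 := mul_le_mul_of_nonneg_left (l1_restrict_le (supp b) δ) hlam1.le
  have h4 : lam2 * (2 * l2 b * l2 (restrict (supp b) δ)) =
      lam1 * √((supp b).card : ℝ) * l2 (restrict (supp b) δ) := by
    rw [← htun]; ring
  have hfin := M.l1_le_of_basic_inequality hc hlam0 hlam htun hφ hΔ hξ (by
    simp only [criterion] at hcrit
    rw [excessRisk, hrisk]
    linarith)
  rw [hδl1, ht, div_mul_eq_mul_div, div_le_iff₀ hRT] at hfin
  rw [← hR] at hfin
  have h6 : R * T ≤ R * ((R + T) / 2) := by linarith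
  have := le_of_mul_le_mul_left h6 hR0
  linarith

end Model

/-! ### The empirical process over an `ℓ₁`-ball. -/

namespace Model

variable {Ω : Type u} [MeasurableSpace Ω] {P : Measure Ω} {n : ℕ} (M : Model.{u, v} P n)

lemma abs_lin_apply_le {K : ℝ} (hψ : ∀ j x, |(M.ψ j : M.XSpace → ℝ) x| ≤ K) (β : Fin M.p → ℝ)
    (x : M.XSpace) : |(M.lin β : M.XSpace → ℝ) x| ≤ K * l1 β := by
  rw [lin_apply, l1, Finset.mul_sum]
  refine (Finset.abs_sum_le_sum_abs _ _).trans (Finset.sum_le_sum fun j _ => ?_)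
  rw [abs_mul, mul_comm]
  exact mul_le_mul_of_nonneg_right (hψ j x) (abs_nonneg _)

lemma lin_sub_apply (β β' : Fin M.p → ℝ) (x : M.XSpace) :
    (M.lin β : M.XSpace → ℝ) x - (M.lin β' : M.XSpace → ℝ) x =
      (M.lin (β - β') : M.XSpace → ℝ) x := by
  rw [lin_sub]; rfl

/-- The increments of the centred empirical process do not see constants. -/
lemma risk_sub_empRisk_sub [IsProbabilityMeasure P] (f f' : M.F) (κ : ℝ) (ω : Ω) :
    (M.risk f - M.empRisk f ω) - (M.risk f' - M.empRisk f' ω) =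
      1 / (n : ℝ) * ∑ i, (∫ ω', (M.ρ f (M.X i ω', M.Y i ω') - M.ρ f' (M.X i ω', M.Y i ω') - κ) ∂P -
        (M.ρ f (M.X i ω, M.Y i ω) - M.ρ f' (M.X i ω, M.Y i ω) - κ)) := by
  have h : ∀ i, ∫ ω', (M.ρ f (M.X i ω', M.Y i ω') - M.ρ f' (M.X i ω', M.Y i ω') - κ) ∂P =
      ∫ ω', M.ρ f (M.X i ω', M.Y i ω') ∂P - ∫ ω', M.ρ f' (M.X i ω', M.Y i ω') ∂P - κ := fun i => by
    have hi : Integrable (fun ω' => M.ρ f (M.X i ω', M.Y i ω') - M.ρ f' (M.X i ω', M.Y i ω')) P :=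
      (M.integrable_ρ f i).sub (M.integrable_ρ f' i)
    rw [integral_sub hi (integrable_const κ),
      integral_sub (M.integrable_ρ f i) (M.integrable_ρ f' i), integral_const]
    simp
  simp only [h, risk, empRisk, Finset.sum_sub_distrib]
  ring

variable [IsProbabilityMeasure P]

/-- The empirical process is Lipschitz in the coefficients. -/
lemma abs_risk_sub_empRisk_sub_le {D K : ℝ} (hD : 0 ≤ D) (hn : n ≠ 0) (hL : M.LipschitzLoss D)
    (hψ : ∀ j x, |(M.ψ j : M.XSpace → ℝ) x| ≤ K) (β : Fin M.p → ℝ) (hβ : β ∈ M.Φ)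
    (β' : Fin M.p → ℝ) (hβ' : β' ∈ M.Φ) (ω : Ω) :
    |(M.risk (M.lin β) - M.empRisk (M.lin β) ω) - (M.risk (M.lin β') - M.empRisk (M.lin β') ω)| ≤
      2 * (D * K) * l1 (β - β') := by
  obtain ⟨γ, c, hρ, hγ⟩ := hL
  set C := D * K * l1 (β - β') with hC
  have hb : ∀ i ω', |M.ρ (M.lin β) (M.X i ω', M.Y i ω') - M.ρ (M.lin β') (M.X i ω', M.Y i ω') -
      (c (M.lin β) - c (M.lin β'))| ≤ C := fun i ω' => by
    rw [hρ, hρ, show ∀ a b c d : ℝ, a + b - (c + d) - (b - d) = a - c by intros; ring, hC, mul_assoc]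
    refine (hγ _ _ β hβ β' hβ').trans (mul_le_mul_of_nonneg_left ?_ hD)
    rw [lin_sub_apply]
    exact M.abs_lin_apply_le hψ _ _
  have hn' : (0 : ℝ) < n := by exact_mod_cast Nat.pos_of_ne_zero hn
  rw [M.risk_sub_empRisk_sub _ _ (c (M.lin β) - c (M.lin β')), abs_mul,
    abs_of_nonneg (by positivity : (0 : ℝ) ≤ 1 / n), one_div_mul_eq_div, div_le_iff₀ hn']
  calc _ ≤ ∑ _i : Fin n, 2 * C := by
        refine (Finset.abs_sum_le_sum_abs _ _).trans (Finset.sum_le_sum fun i _ => ?_)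
        have h1 := norm_integral_le_of_norm_le_const (μ := P) (C := C)
          (f := fun ω' => M.ρ (M.lin β) (M.X i ω', M.Y i ω') -
            M.ρ (M.lin β') (M.X i ω', M.Y i ω') - (c (M.lin β) - c (M.lin β')))
          (Eventually.of_forall fun ω' => hb i ω')
        rw [probReal_univ, mul_one, Real.norm_eq_abs] at h1
        refine (abs_sub _ _).trans ?_
        linarith [hb i ω]
    _ = _ := by simp [hC]; ring

/-- With high probability, the increments of the empirical process over an `ℓ₁`-ball of radius `R`
around `b` are at most `4 K D √(log p / n) R`. -/
lemma measure_exists_lt_risk_sub_empRisk_le {D K R : ℝ} (hD : 0 < D) (hK : 0 < K) (hR : 0 < R)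
    (hn : n ≠ 0) (hp : 2 ≤ M.p) (hL : M.LipschitzLoss D)
    (hψ : ∀ j x, |(M.ψ j : M.XSpace → ℝ) x| ≤ K) {b : Fin M.p → ℝ} (hb : b ∈ M.Φ) :
    P {ω | ∃ β ∈ M.Φ, l1 (β - b) ≤ R ∧ 4 * K * D * √(Real.log M.p / n) * R <
      (M.risk (M.lin β) - M.empRisk (M.lin β) ω) - (M.risk (M.lin b) - M.empRisk (M.lin b) ω)} ≤
      ENNReal.ofReal (2 / M.p) := by
  have hLip := M.abs_risk_sub_empRisk_sub_le hD.le hn hL hψ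
  obtain ⟨γ, c, hρ, hγ⟩ := hL
  have hn' : (0 : ℝ) < n := by exact_mod_cast Nat.pos_of_ne_zero hn
  have hp' : (1 : ℝ) < M.p := by exact_mod_cast hp
  have hlog : 0 < Real.log M.p := Real.log_pos hp'
  set q := √(Real.log M.p / n) with hq
  have hq0 : 0 < q := Real.sqrt_pos.2 (by positivity)
  have hq2 : n * q ^ 2 = Real.log M.p := by
    rw [hq, Real.sq_sqrt (by positivity)]
    field_simp
  -- The Chernoff parameter. The scaled process has log-moment cost `n (2q)² / 2 = 2 log p` and
  -- threshold `4 log p`; with the factor `2p` the tail is `2p · p⁻² = 2 / p`.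
  set θ := q / (D * R * K) with hθ
  have hθ0 : 0 < θ := by positivity
  have : Nonempty (Fin M.p) := ⟨⟨0, by omega⟩⟩
  let V : Ω → (Fin M.p → ℝ) → ℝ := fun ω β =>
    (M.risk (M.lin β) - M.empRisk (M.lin β) ω) - (M.risk (M.lin b) - M.empRisk (M.lin b) ω)
  let S : Set (Fin M.p → ℝ) := {β | β ∈ M.Φ ∧ l1 (β - b) ≤ R}
  have : Nonempty S := ⟨⟨b, hb, by simpa [l1] using hR.le⟩⟩
  -- The tail bound is for finite index sets. Since `V` is continuous in `β` and the inequality is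
  -- strict, a violation anywhere occurs at a point of a dense sequence, hence within a finite
  -- initial segment.
  let s : ℕ → S := TopologicalSpace.denseSeq S
  have hcont : ∀ ω, Continuous fun β : S => V ω β := fun ω => by
    rw [continuous_iff_continuousAt]
    intro β
    rw [ContinuousAt, tendsto_iff_norm_sub_tendsto_zero]
    have hlim : Tendsto (fun β' : S => 2 * (D * K) * l1 ((β' : Fin M.p → ℝ) - (β : Fin M.p → ℝ))) (𝓝 β) (𝓝 0) := by
      have : Continuous fun β' : S => 2 * (D * K) * l1 ((β' : Fin M.p → ℝ) - (β : Fin M.p → ℝ)) := by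
        unfold l1
        fun_prop
      simpa [l1] using this.tendsto β
    refine squeeze_zero (fun _ => norm_nonneg _) (fun β' => ?_) hlim
    rw [Real.norm_eq_abs]
    simp only [V, sub_sub_sub_cancel_right]
    exact hLip _ β'.2.1 _ β.2.1 ω
  let U : ℕ → Set Ω := fun N => {ω | ∃ k : Fin (N + 1), 4 * K * D * q * R ≤ V ω (s k)}
  have hsub : {ω | ∃ β ∈ M.Φ, l1 (β - b) ≤ R ∧ 4 * K * D * q * R < V ω β} ⊆ ⋃ N, U N := by
    rintro ω ⟨β, hβ, hβR, hV⟩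
    obtain ⟨k, hk⟩ := (TopologicalSpace.denseRange_denseSeq S).exists_mem_open
      (isOpen_lt continuous_const (hcont ω)) ⟨⟨β, hβ, hβR⟩, hV⟩
    exact Set.mem_iUnion.2 ⟨k, Fin.last k, le_of_lt hk⟩
  have hmono : Monotone U := by
    rintro N N' hN ω ⟨k, hk⟩
    exact ⟨Fin.castLE (by omega) k, hk⟩
  refine (measure_mono hsub).trans ?_
  rw [hmono.measure_iUnion]
  refine iSup_le fun N => ?_
  let W : Fin n → Ω → M.XSpace × M.YSpace := fun i ω => (M.X i ω, M.Y i ω)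
  let g : Fin (N + 1) → M.XSpace × M.YSpace → ℝ := fun k z =>
    -- Subtracting the difference of the constants `c` leaves an increment of `γ`, to which the
    -- Lipschitz condition applies.
    θ * (M.ρ (M.lin (s k)) z - M.ρ (M.lin b) z - (c (M.lin (s k)) - c (M.lin b)))
  have hgγ : ∀ k z, g k z = θ * (γ z.2 ((M.lin (s k) : M.XSpace → ℝ) z.1) -
      γ z.2 ((M.lin b : M.XSpace → ℝ) z.1)) := fun k z => by
    simp only [g]
    rw [← Prod.mk.eta (p := z), hρ, hρ]
    ring
  have hlin : ∀ (k : Fin (N + 1)) (z : M.XSpace × M.YSpace),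
      ∑ j, ((s k : Fin M.p → ℝ) - b) j * (θ * D * (M.ψ j : M.XSpace → ℝ) z.1) =
        θ * (D * ((M.lin (s k) : M.XSpace → ℝ) z.1 - (M.lin b : M.XSpace → ℝ) z.1)) := fun k z => by
    rw [lin_sub_apply, lin_apply, Finset.mul_sum, Finset.mul_sum]
    exact Finset.sum_congr rfl fun j _ => by ring
  have main := measure_exists_le_of_lipschitz (P := P) (B := θ * D * K) hR.le
    (fun k : Fin (N + 1) => (s k : Fin M.p → ℝ) - b) (fun k => (s k).2.2)
    (fun j z => θ * D * (M.ψ j : M.XSpace → ℝ) z.1)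
    (fun j => ((M.measurable_ψ j).comp measurable_fst).const_mul _)
    (fun j z => by
      rw [abs_mul, abs_of_pos (by positivity : 0 < θ * D)]
      exact mul_le_mul_of_nonneg_left (hψ j _) (by positivity))
    g (fun k => (((M.measurable_ρ _).sub (M.measurable_ρ _)).sub_const _).const_mul _)
    (fun k z => by
      rw [hgγ, hlin, abs_mul, abs_mul, abs_mul D, abs_of_pos hD]
      exact mul_le_mul_of_nonneg_left (hγ _ _ _ (s k).2.1 _ hb) (abs_nonneg _))
    (fun k l z => by
      rw [hgγ, hgγ, hlin, hlin, ← mul_sub, ← mul_sub, ← mul_sub, sub_sub_sub_cancel_right,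
        sub_sub_sub_cancel_right, abs_mul, abs_mul, abs_mul D, abs_of_pos hD]
      exact mul_le_mul_of_nonneg_left (hγ _ _ _ (s k).2.1 _ (s l).2.1) (abs_nonneg _))
    W (fun i => (M.measurable_X i).prodMk (M.measurable_Y i)) M.indep (4 * Real.log M.p)
  have hVg : ∀ (k : Fin (N + 1)) ω, ∑ i, (∫ ω', g k (W i ω') ∂P - g k (W i ω)) =
      θ * n * V ω (s k) := fun k ω => by
    simp only [V]
    rw [M.risk_sub_empRisk_sub _ _ (c (M.lin (s k)) - c (M.lin b))]
    simp only [g, W, integral_const_mul, ← mul_sub, ← Finset.mul_sum]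
    field_simp
  have hthr : θ * n * (4 * K * D * q * R) = 4 * Real.log M.p := by
    rw [← hq2, hθ]
    field_simp
  refine (measure_mono ?_).trans (main.trans (ENNReal.ofReal_le_ofReal (le_of_eq ?_)))
  · rintro ω ⟨k, hk⟩
    refine ⟨k, ?_⟩
    rw [hVg, ← hthr]
    exact mul_le_mul_of_nonneg_left hk (by positivity)
  · have h1 : n * ((2 * R * (θ * D * K)) ^ 2 / 2) - 4 * Real.log M.p = -(2 : ℕ) * Real.log M.p := by
      have : R * (θ * D * K) = q := by rw [hθ]; field_simp
      rw [mul_assoc, this, ← hq2]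
      push_cast
      ring
    have hp0 : (0 : ℝ) < M.p := by linarith
    rw [h1, neg_mul, Real.exp_neg, Real.exp_nat_mul, Real.exp_log hp0, Fintype.card_fin]
    field_simp

end Model

/-! ### The rate, and the proof of the theorem. -/

/-- The rate of the `ℓ₁`-error vanishes. -/
lemma tendsto_rate {p s : ℕ → ℕ} {a b : ℝ} (ha : 0 < a) (hab : a + 2 * b < 1)
    (hp : (fun n => (p n : ℝ)) =O[atTop] fun n : ℕ => Real.exp ((n : ℝ) ^ a))
    (hs : (fun n => (s n : ℝ)) =O[atTop] fun n : ℕ => (n : ℝ) ^ b)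
    (hp2 : ∀ᶠ n in atTop, 2 ≤ p n) :
    Tendsto (fun n : ℕ => √(Real.log (p n) / n) * s n) atTop (𝓝 0) := by
  obtain ⟨C, hC, hpC⟩ := hp.exists_pos
  obtain ⟨C', hC', hsC⟩ := hs.exists_pos
  -- The bound `p ≤ C exp (n ^ a)` gives `log p ≤ log C + n ^ a`. The `log C` term also vanishes,
  -- since `2b < 1 - a < 1`.
  have key : Tendsto (fun n : ℕ => √((n : ℝ) ^ (a + 2 * b - 1) +
      Real.log C * (n : ℝ) ^ (2 * b - 1)) * C') atTop (𝓝 0) := by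
    have h1 : Tendsto (fun n : ℕ => (n : ℝ) ^ (a + 2 * b - 1)) atTop (𝓝 0) := by
      have := (tendsto_rpow_neg_atTop (y := 1 - (a + 2 * b)) (by linarith)).comp
        tendsto_natCast_atTop_atTop
      simpa [Function.comp_def] using this
    have h2 : Tendsto (fun n : ℕ => (n : ℝ) ^ (2 * b - 1)) atTop (𝓝 0) := by
      have := (tendsto_rpow_neg_atTop (y := 1 - 2 * b) (by linarith)).comp
        tendsto_natCast_atTop_atTop
      simpa [Function.comp_def] using this
    have h3 := ((h1.add (h2.const_mul (Real.log C))).sqrt).mul_const C'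
    simpa using h3
  refine squeeze_zero' (Eventually.of_forall fun n => by positivity) ?_ key
  filter_upwards [hpC.bound, hsC.bound, hp2, eventually_gt_atTop 0] with n h1 h2 h3 h4
  have hn : (0 : ℝ) < n := by exact_mod_cast h4
  have hpn : (0 : ℝ) < p n := by exact_mod_cast (by omega : 0 < p n)
  rw [Real.norm_of_nonneg hpn.le, Real.norm_of_nonneg (Real.exp_pos _).le] at h1
  rw [Real.norm_of_nonneg (Nat.cast_nonneg _), Real.norm_of_nonneg (by positivity)] at h2
  have hlog : Real.log (p n) ≤ Real.log C + (n : ℝ) ^ a := by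
    have := Real.log_le_log hpn h1
    rwa [Real.log_mul hC.ne' (Real.exp_pos _).ne', Real.log_exp] at this
  have hnb : (n : ℝ) ^ b = √((n : ℝ) ^ (2 * b)) := by
    rw [Real.sqrt_eq_rpow, ← Real.rpow_mul hn.le]
    congr 1
    ring
  calc √(Real.log (p n) / n) * s n
      ≤ √((Real.log C + (n : ℝ) ^ a) / n) * (C' * (n : ℝ) ^ b) := by gcongr
    _ = √((Real.log C + (n : ℝ) ^ a) / n * (n : ℝ) ^ (2 * b)) * C' := by
      rw [Real.sqrt_mul' _ (by positivity), ← hnb]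
      ring
    _ = _ := by
      rw [Real.rpow_sub hn, Real.rpow_sub hn, Real.rpow_add hn, Real.rpow_one]
      congr 2
      field_simp
      ring

end ElasticNet

theorem corollary3 (K : ℝ) (hK : 0 < K) :
    ∃ d : ℝ, 0 < d ∧
      ∀ (Ω : Type u) [MeasurableSpace Ω] (P : Measure Ω) [IsProbabilityMeasure P]
        (M : ∀ n : ℕ, ElasticNet.Model.{u, v} P n)
        (f₀ : ∀ n, (M n).F) (β₀ βstar : ∀ n, Fin (M n).p → ℝ)
        (βhat : ∀ n, Ω → Fin (M n).p → ℝ)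
        (η lam0 lam1 lam2 : ℕ → ℝ) (a b c D L φ₀ : ℝ),
        0 < a → 0 ≤ b → a + 2 * b < 1 → 0 < c → 0 < D → 8 ≤ L → 0 < φ₀ →
        -- dimension and sparsity
        Tendsto (fun n => (M n).p) atTop atTop →
        (fun n => ((M n).p : ℝ)) =O[atTop] (fun n : ℕ => Real.exp ((n : ℝ) ^ a)) →
        (fun n => ((ElasticNet.supp (β₀ n)).card : ℝ)) =O[atTop] (fun n : ℕ => (n : ℝ) ^ b) →
        (∀ᶠ n in atTop, 2 ≤ (M n).p ∧ Real.log (M n).p ≤ n) →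
        -- the target is linear
        (∀ᶠ n in atTop, (M n).IsTarget (f₀ n) ∧ f₀ n = (M n).lin (β₀ n) ∧
          β₀ n ∈ (M n).Φ ∧ β₀ n ≠ 0) →
        -- loss and basis functions
        (∀ᶠ n in atTop, (M n).LipschitzLoss D ∧ (M n).BoundedBasis K) →
        -- tuning parameters
        (∀ᶠ n in atTop, lam0 n = d * D * √(Real.log (M n).p / n) ∧
          8 * lam0 n ≤ lam1 n ∧ lam1 n ≤ L * lam0 n ∧
          lam2 n = lam1 n * √((ElasticNet.supp (β₀ n)).card : ℝ) /
            (2 * ElasticNet.l2 (βstar n))) →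
        -- quadratic margin, oracle, local condition
        (∀ᶠ n in atTop, 0 < η n ∧
          (M n).MarginCondition (f₀ n) (η n) (fun u => c * u ^ 2) ∧
          (M n).IsTunedOracle (f₀ n) (fun u => c * u ^ 2) (lam1 n)
            {ElasticNet.supp (β₀ n)} (βstar n) ∧
          (M n).LocalCondition (f₀ n) (η n) (fun u => c * u ^ 2) (lam0 n) (lam1 n) (lam2 n)
            (βstar n)) →
        -- the adaptive restricted eigenvalue is bounded away from zero
        (∀ᶠ n in atTop,
          φ₀ ≤ (M n).phiSq (lam1 n) (lam2 n) (βstar n) (ElasticNet.supp (β₀ n))) →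
        -- the elastic net estimator
        (∀ᶠ n in atTop, ∀ ω, (M n).IsElasticNet (lam1 n) (lam2 n) ω (βhat n ω)) →
        TendstoInMeasure P (fun n ω => ElasticNet.l1 (βhat n ω - β₀ n)) atTop (fun _ => 0) := by
  refine ⟨4 * K, by positivity, ?_⟩
  intro Ω _ P _ M f₀ β₀ βstar βhat η lam0 lam1 lam2 a b c D L φ₀ ha _ hab hc hD hL hφ₀ hp hpO hsO
    hp2 htarget hloss htuning horacle hphi hbhat
  have hrate := ElasticNet.tendsto_rate ha hab hpO hsO (hp2.mono fun n h => h.1)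
  -- The constant arises from `Δ*/λ₀ = 9 λ₁² s / (c φ² λ₀)` by `λ₁ ≤ L λ₀`, `φ² ≥ φ₀` and `λ₀ = 4 K
  -- D √(log p / n)`.
  have hrate' := hrate.const_mul (9 * L ^ 2 * (4 * K * D) / (c * φ₀))
  rw [mul_zero] at hrate'
  have hprob : Tendsto (fun n => ENNReal.ofReal (2 / ((M n).p : ℝ))) atTop (𝓝 0) := by
    have h := tendsto_const_nhds (x := (2 : ℝ)).div_atTop (tendsto_natCast_atTop_atTop.comp hp)
    simpa using ENNReal.tendsto_ofReal h
  rw [tendstoInMeasure_iff_norm]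
  intro ε hε
  refine tendsto_of_tendsto_of_tendsto_of_le_of_le' tendsto_const_nhds hprob
    (Eventually.of_forall fun _ => zero_le) ?_
  filter_upwards [hp2, htarget, hloss, htuning, horacle, hphi, hbhat,
    hrate'.eventually_lt_const hε, eventually_gt_atTop 0] with n hp2 htarget hloss htuning horacle
    hphi hbhat hrate hn
  obtain ⟨hp2, -⟩ := hp2
  obtain ⟨-, hf₀, hβΦ, hβ0⟩ := htarget
  obtain ⟨hlip, -, hψ⟩ := hloss
  obtain ⟨hlam0, hlam1, hlam1', hlam2⟩ := htuning
  obtain ⟨-, hmargin, horacle, hloc⟩ := horacle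
  have hn' : (0 : ℝ) < n := by exact_mod_cast hn
  have hlog : 0 < Real.log (M n).p := Real.log_pos (by exact_mod_cast hp2)
  have hlam0_pos : 0 < lam0 n := by rw [hlam0]; positivity
  have hlam1_pos : 0 < lam1 n := by linarith
  have hlam2_nonneg : 0 ≤ lam2 n / lam1 n := by
    have := ElasticNet.l2_nonneg (βstar n)
    rw [hlam2]
    positivity
  have hstar : βstar n = β₀ n := (M n).eq_of_isTunedOracle hc hf₀ hβ0 hmargin horacle hloc.1 hφ₀
    hphi hlam2_nonneg
  rw [hstar] at hlam2 hloc hphi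
  have htun : 2 * lam2 n * ElasticNet.l2 (β₀ n) =
      lam1 n * √((ElasticNet.supp (β₀ n)).card : ℝ) := by
    rw [hlam2]
    exact ElasticNet.tunedLambda2_mul_l2 (lam1 n) hβ0
  have hphi_pos := hφ₀.trans_le hphi
  have hΔ := (M n).delta_eq hc hlam1_pos.le hf₀ htun hphi_pos
  have hbound := fun ω hev => (M n).l1_elasticNet_sub_le hc hlam0_pos hlam1 hf₀ hβ0 hβΦ htun
    hphi_pos hmargin hloc (hbhat ω) hev
  set Δ := (M n).Delta (f₀ n) (fun u => c * u ^ 2) (lam1 n) (lam2 n) (β₀ n)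
  set r := (M n).phiSq (lam1 n) (lam2 n) (β₀ n) (ElasticNet.supp (β₀ n))
  have hcard : (0 : ℝ) < (ElasticNet.supp (β₀ n)).card := by
    exact_mod_cast Finset.card_pos.2 (ElasticNet.supp_nonempty.2 hβ0)
  have hΔ_pos : 0 < Δ := by rw [hΔ]; positivity
  have hsmall : Δ / lam0 n < ε := by
    refine lt_of_le_of_lt ?_ hrate
    calc Δ / lam0 n = 9 * lam1 n ^ 2 * (ElasticNet.supp (β₀ n)).card / (c * r) / lam0 n := by
          rw [hΔ]
      _ ≤ 9 * (L * lam0 n) ^ 2 * (ElasticNet.supp (β₀ n)).card / (c * φ₀) / lam0 n := by gcongr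
      _ = 9 * L ^ 2 * lam0 n * (ElasticNet.supp (β₀ n)).card / (c * φ₀) := by field_simp
      _ = _ := by rw [hlam0]; ring
  -- For radius `R = Δ/λ₀` the deviation threshold `λ₀ R` is exactly `Δ`. Off the exceptional event
  -- the error is thus at most `Δ/λ₀ < ε`. Monotonicity of the outer measure suffices, so no
  -- measurability of `βhat` is needed.
  refine le_trans (measure_mono ?_) ((M n).measure_exists_lt_risk_sub_empRisk_le hD hK
    (div_pos hΔ_pos hlam0_pos) hn.ne' hp2 hlip hψ hβΦ)
  intro ω hω
  by_contra hgood
  simp only [Set.mem_ofPred_eq, not_exists, not_and, not_lt, ← hlam0,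
    mul_div_cancel₀ _ hlam0_pos.ne'] at hgood
  have h1 := hbound ω hgood
  simp only [Set.mem_ofPred_eq, sub_zero, Real.norm_eq_abs,
    abs_of_nonneg (ElasticNet.l1_nonneg _)] at hω
  linarith
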